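/- Let $\mathbb{F}$ be a field of characteristic zero, let $d\ge 1$, and for $\mathbf{k},\mathbf{k}'\in\mathbb{N}^d$ (with $0\in\mathbb{N}$) write $\mathbf{k}\preceq\mathbf{k}'$ if $k_i\le k'_i$ for all $i$. Put $\mathbf{n}!=n_1!\cdots n_d!$. Let $\Delta_{x_i}p = p - p(x_1,\dots,x_i-1,\dots,x_d)$ be the backward difference operator in the variable $x_i$ on $\mathbb{F}[x_1,\dots,x_d]$. For $\mathbf{n}\in\mathbb{N}^d$ and a grid $\boldsymbol{Z}=\{z_{\mathbf{k}}\in\mathbb{F}^d:\mathbf{k}\preceq\mathbf{n}\}$, let $\tilde g_{\mathbf{n}}(\mathbf{x};\boldsymbol{Z})$ be the multivariate difference Gončarov polynomial, that is, the unique polynomial of degree at most $n_i$ in $x_i$ for every $i$ such that $\Delta_{x_1}^{k_1}\cdots\Delta_{x_d}^{k_d}\,\tilde g_{\mathbf{n}}(\mathbf{x};\boldsymbol{Z})$ takes at $\mathbf{x}=z_{\mathbf{k}}$ the value $\mathbf{n}!$ if $\mathbf{k}=\mathbf{n}$ and $0$ otherwise, for all $\mathbf{k}\preceq\mathbf{n}$.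 Let $\mathbf{x}=(x_1,\dots,x_d),\ \mathbf{n}=(n_1,\dots,n_d)\in\mathbb{N}^d$ and let $\boldsymbol{Z}=\{z_{\mathbf{k}}:\mathbf{k}\preceq\mathbf{n}\}\subset\mathbb{N}^d$ be such that the numbers $u_{\mathbf{k},i}=x_i-z_{\mathbf{k},i}$ are non-negative for all $\mathbf{k}\preceq\mathbf{n}$ and $1\le i\le d$, and satisfy $u_{\mathbf{k},i}\le u_{\mathbf{k}',i}$ whenever $\mathbf{k}\preceq\mathbf{k}'\preceq\mathbf{n}$ and $1\le i\le d$. Put $\boldsymbol{U}=\{u_{\mathbf{k}}:\mathbf{k}\preceq\mathbf{n}\}$ and $-\boldsymbol{U}=\{-u_{\mathbf{k}}:\mathbf{k}\preceq\mathbf{n}\}$. Let $\mathcal{I}(\mathbf{n})$ be the set of $d$-tuples $(\boldsymbol{a}^{(1)},\dots,\boldsymbol{a}^{(d)})$ of non-decreasing integer sequences $\boldsymbol{a}^{(i)}=(a^{(i)}_0,\dots,a^{(i)}_{n_i-1})$ with $0\le a^{(i)}_j<x_i$ for all $i$ and $j$. For a lattice path $P$ from the origin $O$ to $A=\mathbf{n}$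 with unit steps $\mathbf{e}_1,\dots,\mathbf{e}_d$, let $\mathcal{I}_{\mathbf{n}}(P;\boldsymbol{U})$ be the set of those tuples in $\mathcal{I}(\mathbf{n})$ that are bounded by $P$ with respect to $\boldsymbol{U}$, meaning that $a^{(i)}_{k_i}<u_{\mathbf{k},i}$ for every $\mathbf{e}_i$-step of $P$ starting at a point $\mathbf{k}$. Then $$\Bigl|\bigcup_{P:O\to A}\mathcal{I}_{\mathbf{n}}(P;\boldsymbol{U})\Bigr|=\frac{1}{\mathbf{n}!}\,\tilde g_{\mathbf{n}}(\mathbf{x};\boldsymbol{Z})=\frac{1}{\mathbf{n}!}\,\tilde g_{\mathbf{n}}\bigl((0,\dots,0);-\boldsymbol{U}\bigr),$$ where the union is over all lattice paths $P$ from $O$ to $A$. -/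

import Mathlib

open MvPolynomial

/-- The space of polynomials of coordinate degree `n`: all linear combinations of the monomials
`x₁ ^ s₁ ⋯ x_d ^ s_d` with `s i ≤ n i` for every `i`. -/
noncomputable def coordDegreeSpace (F : Type*) [Field F] {d : ℕ} (n : Fin d → ℕ) :
    Submodule F (MvPolynomial (Fin d) F) :=
  MvPolynomial.restrictSupport F {s : Fin d →₀ ℕ | ∀ i, s i ≤ n i}

/-- The unit backward shift in the `i`-th variable,
`p(x₁, …, x_d) ↦ p(x₁, …, x_i - 1, …, x_d)`. -/
noncomputable def backwardShift (F : Type*) [Field F] {d : ℕ} (i : Fin d) :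
    MvPolynomial (Fin d) F →ₐ[F] MvPolynomial (Fin d) F :=
  MvPolynomial.aeval fun j => if j = i then X j - 1 else X j

/-- The backward difference operator `Δ_{x_i} p = p - p(x₁, …, x_i - 1, …, x_d)`. -/
noncomputable def backwardDiff (F : Type*) [Field F] {d : ℕ} (i : Fin d) :
    Module.End F (MvPolynomial (Fin d) F) :=
  1 - (backwardShift F i).toLinearMap

/-- The iterated operator `Δ_{x₁} ^ k₁ ⋯ Δ_{x_d} ^ k_d`. -/
noncomputable def backwardDiffPow (F : Type*) [Field F] {d : ℕ} (k : Fin d → ℕ) :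
    Module.End F (MvPolynomial (Fin d) F) :=
  (List.ofFn fun i => backwardDiff F i ^ k i).prod

/-- `𝐧! = n₁! ⋯ n_d!`. -/
def multiFactorial {d : ℕ} (n : Fin d → ℕ) : ℕ := ∏ i, (n i).factorial

/-- The biorthogonality conditions that characterise the multivariate difference Gončarov
polynomial indexed by `n` on the grid `Z`: the polynomial `p` has coordinate degree `n`, and
`ε(z_k) Δ_{x₁} ^ k₁ ⋯ Δ_{x_d} ^ k_d p = 𝐧! δ_{k,n}` for all `k ≤ n`. -/
def IsDiffGoncarov {F : Type*} [Field F] {d : ℕ} (n : Fin d → ℕ)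
    (Z : (Fin d → ℕ) → Fin d → F) (p : MvPolynomial (Fin d) F) : Prop :=
  p ∈ coordDegreeSpace F n ∧
    ∀ k : Fin d → ℕ, k ≤ n →
      eval (Z k) (backwardDiffPow F k p) = if k = n then (multiFactorial n : F) else 0

section ExistenceUniqueness

variable {F : Type*} [Field F] {d : ℕ}

theorem backwardDiff_apply (i : Fin d) (p : MvPolynomial (Fin d) F) :
    backwardDiff F i p = p - backwardShift F i p := rfl

theorem backwardShift_comm (i j : Fin d) (p : MvPolynomial (Fin d) F) :
    backwardShift F i (backwardShift F j p) = backwardShift F j (backwardShift F i p) := by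
  have h : (backwardShift F i).comp (backwardShift F j)
      = (backwardShift F j).comp (backwardShift F i) := by
    apply MvPolynomial.algHom_ext
    intro l
    simp only [AlgHom.comp_apply, backwardShift, aeval_X]
    by_cases h1 : l = j <;> by_cases h2 : l = i <;> simp [h1, h2] <;> simp_all
  exact DFunLike.congr_fun h p

theorem backwardDiff_commute (i j : Fin d) :
    Commute (backwardDiff F i) (backwardDiff F j) := by
  refine LinearMap.ext fun p => ?_
  simp only [Module.End.mul_apply, backwardDiff_apply, map_sub, backwardShift_comm i j p]
  ring

theorem commute_prod_ofFn {M : Type*} [Monoid M] {m : ℕ} (f : Fin m → M) (a : M)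
    (h : ∀ j, Commute a (f j)) : Commute a (List.ofFn f).prod := by
  refine Commute.list_prod_right _ _ fun x hx => ?_
  obtain ⟨j, rfl⟩ := List.mem_ofFn.1 hx
  exact h j

theorem prod_ofFn_update {M : Type*} [Monoid M] {m : ℕ} (f : Fin m → M)
    (i : Fin m) (a : M) (h : ∀ j, Commute a (f j)) :
    (List.ofFn (Function.update f i (a * f i))).prod = a * (List.ofFn f).prod := by
  induction m with
  | zero => exact i.elim0
  | succ m ih =>
    rw [List.ofFn_succ, List.ofFn_succ, List.prod_cons, List.prod_cons]
    refine Fin.cases ?_ (fun i => ?_) i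
    · have : (fun j : Fin m => Function.update f 0 (a * f 0) j.succ) = fun j => f j.succ := by
        funext j; simp
      rw [this, Function.update_self, mul_assoc]
    · have : (fun j : Fin m => Function.update f i.succ (a * f i.succ) j.succ)
          = Function.update (fun j : Fin m => f j.succ) i (a * f i.succ) := by
        funext j
        by_cases hj : j = i
        · subst hj; simp
        · have : j.succ ≠ i.succ := fun h => hj (Fin.succ_injective _ h)
          simp [hj]
      rw [this, ih (fun j => f j.succ) i (fun j => h _),
        Function.update_of_ne (Fin.succ_ne_zero i).symm, ← mul_assoc, ← (h 0).eq, mul_assoc]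

theorem backwardDiffPow_succ (k : Fin d → ℕ) (i : Fin d) :
    backwardDiffPow F (Function.update k i (k i + 1))
      = backwardDiff F i * backwardDiffPow F k := by
  unfold backwardDiffPow
  rw [← prod_ofFn_update (fun j => backwardDiff F j ^ k j) i (backwardDiff F i)
    (fun j => (backwardDiff_commute i j).pow_right _)]
  congr 2
  funext j
  by_cases hj : j = i
  · subst hj; simp [pow_succ']
  · simp [hj]

theorem backwardDiffPow_zero : backwardDiffPow F (0 : Fin d → ℕ) = 1 := by
  unfold backwardDiffPow
  refine List.prod_eq_one fun x hx => ?_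
  obtain ⟨j, rfl⟩ := List.mem_ofFn.1 hx
  simp

/-- `Δ_{x_i}` lowers the degree in `x_i`. -/
theorem backwardDiff_lower (i : Fin d) (m : ℕ) (p : MvPolynomial (Fin d) F)
    (hp : p.degreeOf i ≤ m) :
    (m = 0 → backwardDiff F i p = 0) ∧ (backwardDiff F i p).degreeOf i ≤ m - 1 := by
  have key : ∀ e : ℕ, ((X i : MvPolynomial (Fin d) F) ^ e - (X i - 1) ^ e).degreeOf i ≤ e - 1 := by
    intro e
    induction e with
    | zero => simp
    | succ e ih =>
      have h1 : (X i : MvPolynomial (Fin d) F) ^ (e + 1) - (X i - 1) ^ (e + 1)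
          = X i * (X i ^ e - (X i - 1) ^ e) + (X i - 1) ^ e := by ring
      rw [h1]
      refine (degreeOf_add_le _ _ _).trans (max_le ?_ ?_)
      · rcases Nat.eq_zero_or_pos e with rfl | he
        · simp
        · refine (degreeOf_mul_le _ _ _).trans ?_
          rw [degreeOf_X_self]
          omega
      · refine (degreeOf_pow_le _ _ _).trans ?_
        have : (X i - 1 : MvPolynomial (Fin d) F).degreeOf i ≤ 1 := by
          refine (degreeOf_sub_le _ _ _).trans (max_le (by simp) (by simp))
        calc e * _ ≤ e * 1 := Nat.mul_le_mul_left _ this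
          _ = e + 1 - 1 := by omega
  have mono : ∀ s : Fin d →₀ ℕ, ∀ c : F, backwardDiff F i (monomial s c)
      = (X i ^ s i - (X i - 1) ^ s i) * monomial (s.erase i) c := by
    intro s c
    have e1 : (monomial s c : MvPolynomial (Fin d) F) = X i ^ s i * monomial (s.erase i) c := by
      rw [X_pow_eq_monomial, monomial_mul, one_mul, Finsupp.single_add_erase]
    have e2 : backwardShift F i (monomial (s.erase i) c) = monomial (s.erase i) c := by
      rw [backwardShift, aeval_monomial, monomial_eq]
      congr 1
      refine Finset.prod_congr rfl fun j hj => ?_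
      have : j ≠ i := by rintro rfl; simp at hj
      simp [this]
    rw [backwardDiff_apply, e1, map_mul, map_pow, e2, sub_mul]
    simp [backwardShift]
  have expand : backwardDiff F i p = ∑ s ∈ p.support,
      (X i ^ s i - (X i - 1) ^ s i) * monomial (s.erase i) (coeff s p) := by
    conv_lhs => rw [p.as_sum]
    rw [map_sum]
    exact Finset.sum_congr rfl fun s _ => mono s _
  have hs := degreeOf_le_iff.1 hp
  refine ⟨fun hm => ?_, ?_⟩
  · rw [expand]
    refine Finset.sum_eq_zero fun s hsup => ?_
    have : s i = 0 := by have := hs s hsup; omega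
    simp [this]
  · rw [expand]
    refine (degreeOf_sum_le _ _ _).trans (Finset.sup_le fun s hsup => ?_)
    refine (degreeOf_mul_le _ _ _).trans ?_
    have h2 : (monomial (s.erase i) (coeff s p)).degreeOf i = 0 := by
      rw [degreeOf_monomial_eq _ _ (mem_support_iff.1 hsup)]; simp
    have h3 := key (s i)
    have h4 := hs s hsup
    omega

theorem backwardDiff_iterate (i : Fin d) (m : ℕ) (p : MvPolynomial (Fin d) F)
    (hp : p.degreeOf i ≤ m) : (backwardDiff F i ^ (m + 1)) p = 0 := by
  induction m generalizing p with
  | zero => simpa using (backwardDiff_lower i 0 p hp).1 rfl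
  | succ m ih =>
    rw [pow_succ, Module.End.mul_apply]
    exact ih _ (backwardDiff_lower i (m + 1) p hp).2

theorem backwardDiffPow_update_zero (k : Fin d → ℕ) (i : Fin d) (m : ℕ) :
    backwardDiffPow F (Function.update k i m)
      = backwardDiff F i ^ m * backwardDiffPow F (Function.update k i 0) := by
  induction m with
  | zero => simp
  | succ m ih =>
    have := backwardDiffPow_succ (F := F) (Function.update k i m) i
    simp only [Function.update_self, Function.update_idem] at this
    rw [this, ih, pow_succ', mul_assoc]

theorem backwardDiffPow_commute (k : Fin d → ℕ) (i : Fin d) :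
    Commute (backwardDiff F i) (backwardDiffPow F k) :=
  commute_prod_ofFn _ _ fun j => (backwardDiff_commute i j).pow_right _

/-- Only constants are annihilated by all the backward difference operators. -/
theorem eq_C_of_backwardDiff_eq_zero [CharZero F] (p : MvPolynomial (Fin d) F)
    (h : ∀ i, backwardDiff F i p = 0) : p = C (eval 0 p) := by
  have hev : ∀ (i : Fin d) (x : Fin d → F) (q : MvPolynomial (Fin d) F),
      eval x (backwardShift F i q) = eval (Function.update x i (x i - 1)) q := by
    intro i x q
    induction q using MvPolynomial.induction_on with
    | C a => simp [backwardShift]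
    | add p q hp hq => simp [hp, hq]
    | mul_X p j hp =>
      rw [map_mul, map_mul, map_mul, hp]
      congr 1
      by_cases hj : j = i
      · subst hj; simp [backwardShift]
      · simp [backwardShift, hj]
  have hshift : ∀ (i : Fin d) (x : Fin d → F),
      eval (Function.update x i (x i - 1)) p = eval x p := by
    intro i x
    have h1 : p = backwardShift F i p := sub_eq_zero.1 (h i)
    conv_rhs => rw [h1]
    rw [hev]
  have hnat : ∀ (N : ℕ) (m : Fin d → ℕ), ∑ i, m i = N →
      eval (fun i => -(m i : F)) p = eval 0 p := by
    intro N
    induction N with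
    | zero =>
      intro m hm
      have : ∀ i, m i = 0 := by simpa using hm
      congr 2
      funext i
      simp [this i]
    | succ N ih =>
      intro m hm
      obtain ⟨i, hi⟩ : ∃ i, m i ≠ 0 := by
        by_contra! hc
        simp [hc] at hm
      have hsum := Finset.sum_update_of_mem (Finset.mem_univ i) m (m i - 1)
      have hsum2 := Finset.add_sum_erase Finset.univ m (Finset.mem_univ i)
      rw [Finset.sdiff_singleton_eq_erase] at hsum
      rw [← ih (Function.update m i (m i - 1)) (by omega),
        ← hshift i (fun j => -((Function.update m i (m i - 1) j : ℕ) : F))]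
      congr 2
      funext j
      by_cases hj : j = i
      · subst hj
        rw [Function.update_self, Function.update_self, Nat.cast_sub (by omega)]
        push_cast
        ring
      · simp [hj]
  refine funext_set (fun _ => Set.range fun a : ℕ => -(a : F)) (fun _ => ?_) fun x hx => ?_
  · exact Set.infinite_range_of_injective fun a b hab => by simpa using hab
  · choose m hm using fun i => hx i trivial
    rw [eval_C, ← hnat _ m rfl]
    congr 2
    funext i
    exact (hm i).symm

theorem degreeOf_le_of_mem_coordDegreeSpace {n : Fin d → ℕ} {p : MvPolynomial (Fin d) F}
    (hp : p ∈ coordDegreeSpace F n) (i : Fin d) : p.degreeOf i ≤ n i :=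
  degreeOf_le_iff.2 fun _ hs => ((mem_restrictSupport_iff F).1 hp) hs i

/-- A polynomial of coordinate degree `n` is determined by its interpolation data. -/
theorem eq_zero_of_interpolation [CharZero F] {n : Fin d → ℕ} (Z : (Fin d → ℕ) → Fin d → F)
    {p : MvPolynomial (Fin d) F} (hp : p ∈ coordDegreeSpace F n)
    (h : ∀ k, k ≤ n → eval (Z k) (backwardDiffPow F k p) = 0) : p = 0 := by
  have main : ∀ (N : ℕ) (k : Fin d → ℕ), k ≤ n → ∑ i, (n i - k i) = N →
      backwardDiffPow F k p = 0 := by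
    intro N
    induction N using Nat.strong_induction_on with
    | _ N ih =>
      intro k hk hN
      have hconst : ∀ i, backwardDiff F i (backwardDiffPow F k p) = 0 := by
        intro i
        rw [← Module.End.mul_apply, ← backwardDiffPow_succ]
        by_cases hi : k i = n i
        · rw [backwardDiffPow_update_zero, hi,
            (((backwardDiffPow_commute (F := F) _ i).pow_left (n i + 1)).eq :),
            Module.End.mul_apply,
            backwardDiff_iterate i (n i) p (degreeOf_le_of_mem_coordDegreeSpace hp i), map_zero]
        · have hlt : k i < n i := lt_of_le_of_ne (hk i) hi
          refine ih _ ?_ (Function.update k i (k i + 1)) ?_ rfl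
          · rw [← hN]
            refine Finset.sum_lt_sum (fun j _ => ?_) ⟨i, Finset.mem_univ i, ?_⟩
            · by_cases hj : j = i
              · rw [hj, Function.update_self]; omega
              · simp [hj]
            · rw [Function.update_self]; omega
          · intro j
            by_cases hj : j = i
            · rw [hj, Function.update_self]; exact hlt
            · simpa [hj] using hk j
      have hC := eq_C_of_backwardDiff_eq_zero _ hconst
      have h0 := h k hk
      rw [hC, eval_C] at h0
      rw [hC, h0, C_0]
  have := main _ 0 (fun i => Nat.zero_le _) rfl
  rwa [backwardDiffPow_zero] at this

/-- There is exactly one polynomial satisfying the biorthogonality conditions. -/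
theorem existsUnique_isDiffGoncarov [CharZero F] (n : Fin d → ℕ)
    (Z : (Fin d → ℕ) → Fin d → F) : ∃! p, IsDiffGoncarov n Z p := by
  let e : {s : Fin d →₀ ℕ | ∀ i, s i ≤ n i} ≃ Set.Iic n :=
    Finsupp.equivFunOnFinite.subtypeEquiv fun s => Iff.rfl
  have : Finite {s : Fin d →₀ ℕ | ∀ i, s i ≤ n i} := Finite.of_equiv _ e.symm
  have := Fintype.ofFinite {s : Fin d →₀ ℕ | ∀ i, s i ≤ n i}
  have := Fintype.ofFinite (Set.Iic n)
  let b : Module.Basis {s : Fin d →₀ ℕ | ∀ i, s i ≤ n i} F (coordDegreeSpace F n) :=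
    basisRestrictSupport F _
  have : Module.Finite F (coordDegreeSpace F n) := Module.Finite.of_basis b
  let L : coordDegreeSpace F n →ₗ[F] (Set.Iic n → F) :=
    LinearMap.pi fun k => (aeval (Z k.1)).toLinearMap ∘ₗ backwardDiffPow F k.1 ∘ₗ
      (coordDegreeSpace F n).subtype
  have hL : ∀ p k, L p k = eval (Z k.1) (backwardDiffPow F k.1 p.1) := by
    intro p k
    simp [L, aeval_eq_eval]
  have hinj : Function.Injective L := by
    rw [← LinearMap.ker_eq_bot, LinearMap.ker_eq_bot']
    intro p hp
    refine Subtype.ext (eq_zero_of_interpolation Z p.2 fun k hk => ?_)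
    rw [← hL p ⟨k, hk⟩, hp, Pi.zero_apply]
  have hrank : Module.finrank F (coordDegreeSpace F n) = Module.finrank F (Set.Iic n → F) := by
    rw [Module.finrank_eq_card_basis b, Module.finrank_fintype_fun_eq_card]
    exact Fintype.card_congr e
  obtain ⟨p, hp⟩ := (LinearMap.injective_iff_surjective_of_finrank_eq_finrank hrank).1 hinj
    fun k => if k.1 = n then (multiFactorial n : F) else 0
  refine ⟨p.1, ⟨p.2, fun k hk => ?_⟩, fun q hq => ?_⟩
  · rw [← hL p ⟨k, hk⟩, hp]
  · refine sub_eq_zero.1 (eq_zero_of_interpolation Z (Submodule.sub_mem _ hq.1 p.2) ?_)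
    intro k hk
    rw [map_sub, map_sub, hq.2 k hk, ← hL p ⟨k, hk⟩, hp, sub_self]

end ExistenceUniqueness

/-- The multivariate difference Gončarov polynomial `g̃_n(x; Z)`, the unique polynomial of
coordinate degree `n` that satisfies the biorthogonality conditions on the grid `Z`. -/
noncomputable def diffGoncarov {F : Type*} [Field F] [CharZero F] {d : ℕ} (n : Fin d → ℕ)
    (Z : (Fin d → ℕ) → Fin d → F) : MvPolynomial (Fin d) F :=
  (existsUnique_isDiffGoncarov n Z).choose

/-- A lattice path from the origin to `n` with steps in `{e_i}`, recorded as the list of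
directions of its steps: the direction `i` is used exactly `n i` times. -/
structure LatticePath {d : ℕ} (n : Fin d → ℕ) where
  steps : List (Fin d)
  count_steps : ∀ i, steps.count i = n i

namespace LatticePath

variable {d : ℕ} {n : Fin d → ℕ}

/-- The lattice point reached by the path after its first `r` steps. -/
def position (P : LatticePath n) (r : ℕ) : Fin d → ℕ := fun i => (P.steps.take r).count i

theorem position_lt (P : LatticePath n) (r : Fin P.steps.length) :
    P.position r (P.steps.get r) < n (P.steps.get r) := by
  have h : P.steps.count (P.steps.get r) = (P.steps.take r).count (P.steps.get r)
      + (P.steps.drop r).count (P.steps.get r) := by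
    rw [← List.count_append, List.take_append_drop]
  have hpos : 0 < (P.steps.drop r).count (P.steps.get r) := by
    rw [List.count_pos_iff, List.drop_eq_getElem_cons r.2, List.get_eq_getElem]
    exact List.mem_cons_self
  have hn := P.count_steps (P.steps.get r)
  unfold position
  omega

end LatticePath

/-- `𝓘(n)`: the `d`-tuples `(a⁽¹⁾, …, a⁽ᵈ⁾)` of non-decreasing sequences of integers, the `i`-th
of length `n i`, with `0 ≤ a⁽ⁱ⁾_j < x i`. -/
def boundedSequences {d : ℕ} (x n : Fin d → ℕ) : Set ((i : Fin d) → Fin (n i) → ℕ) :=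
  {a | ∀ i, Monotone (a i) ∧ ∀ j, a i j < x i}

/-- `𝓘_n(P; U)`: the members `a` of `𝓘(n)` that are bounded by the path `P` with respect to the
weights `U`: if the `r`-th step of `P` is an `e_i`-step that starts at `k`, then
`a⁽ⁱ⁾_{k_i} < u_{k,i}`. -/
def pathBoundedSequences {d : ℕ} (x n : Fin d → ℕ) (U : (Fin d → ℕ) → Fin d → ℕ)
    (P : LatticePath n) : Set ((i : Fin d) → Fin (n i) → ℕ) :=
  {a | a ∈ boundedSequences x n ∧ ∀ r : Fin P.steps.length,
    a (P.steps.get r) ⟨P.position r (P.steps.get r), P.position_lt r⟩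
      < U (P.position r) (P.steps.get r)}

/-! Path-bounded tuples and normalised Gončarov values solve the same linear system: for every `m ≤
n`, `∏ multichoose (x i) (m i)` is the sum over `k ≤ m` of `∏ multichoose (Z k i) (m i - k i)` times
the unknown with index `k`. The diagonal coefficients are `multichoose _ 0 = 1`, so
`eq_of_unitriangular` makes the two solutions agree.

Algebraic side (`sum_multichoose_mul_diffGoncarov`): the normalised products of rising factorials
have their index lowered from `m` to `m - k` by `Δ ^ k`. Their coefficients in the biorthogonal
Gončarov family are therefore values of polynomials of the same kind, which are multichoose numbers
at natural arguments.

Combinatorial side (`sum_ncard_reachSeqs`): a tuple `a` drives a walk from the origin that may take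
an `e_i`-step at `k` when `a i (k i) < U k i`. Monotonicity of `U` makes the walk inside the box
stop at the same point `k` whatever choices are made. The entries consumed on the way form a tuple
bounded by a path to `k`. The remaining ones are non-decreasing in `[U k i, x i)`, an interval of `Z
k i` integers, and are otherwise arbitrary. -/

theorem multiIndex_induction {d : ℕ} {p : (Fin d → ℕ) → Prop} (zero : p 0)
    (step : ∀ k i, p k → p (Function.update k i (k i + 1))) (k : Fin d → ℕ) : p k := by
  induction hN : ∑ i, k i generalizing k with
  | zero =>
    have : k = 0 := funext fun i => by
      have h : ∀ i, k i = 0 := by simpa using hN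
      exact h i
    exact this ▸ zero
  | succ N ih =>
    obtain ⟨i, hi⟩ : ∃ i, k i ≠ 0 := by
      by_contra! hc
      simp [hc] at hN
    have hsum := Finset.sum_update_of_mem (Finset.mem_univ i) k (k i - 1)
    have hsum2 := Finset.add_sum_erase Finset.univ k (Finset.mem_univ i)
    rw [Finset.sdiff_singleton_eq_erase] at hsum
    have h := step _ i (ih (Function.update k i (k i - 1)) (by omega))
    rwa [Function.update_self, Function.update_idem, Nat.sub_add_cancel (by omega),
      Function.update_eq_self] at h

/-! ### Rising factorials and their backward differences. -/

/-- The rising factorial `y (y + 1) ⋯ (y + l - 1)`. -/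
def risingFactorial {R : Type*} [CommRing R] (y : R) (l : ℕ) : R :=
  ∏ t ∈ Finset.range l, (y + t)

/-- Both products contain `y ⋯ (y + l - 1)`; the remaining factors are `y + l` and `y - 1`, which
differ by `l + 1`. -/
theorem risingFactorial_sub {R : Type*} [CommRing R] (y : R) (l : ℕ) :
    risingFactorial y (l + 1) - risingFactorial (y - 1) (l + 1)
      = (l + 1) * risingFactorial y l := by
  have h : risingFactorial (y - 1) (l + 1) = risingFactorial y l * (y - 1) := by
    unfold risingFactorial
    rw [Finset.prod_range_succ']
    congr 1
    · refine Finset.prod_congr rfl fun t _ => ?_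
      push_cast
      ring
    · simp
  rw [h, risingFactorial, Finset.prod_range_succ, risingFactorial]
  ring

theorem map_risingFactorial {R S G : Type*} [CommRing R] [CommRing S] [FunLike G R S]
    [RingHomClass G R S] (f : G) (y : R) (l : ℕ) :
    f (risingFactorial y l) = risingFactorial (f y) l := by
  simp [risingFactorial]

theorem risingFactorial_natCast {R : Type*} [CommRing R] (y l : ℕ) :
    risingFactorial (y : R) l = (l.factorial : R) * (y.multichoose l : R) := by
  rw [Nat.multichoose_eq, ← Nat.cast_mul, ← Nat.ascFactorial_eq_factorial_mul_choose',
    Nat.ascFactorial_eq_prod_range, risingFactorial]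
  push_cast
  rfl

/-! ### Expansion in Gončarov polynomials and the algebraic convolution identity. -/

section Expansion

variable {F : Type*} [Field F] {d : ℕ}

theorem mem_coordDegreeSpace_iff {n : Fin d → ℕ} {p : MvPolynomial (Fin d) F} :
    p ∈ coordDegreeSpace F n ↔ ∀ i, p.degreeOf i ≤ n i :=
  ⟨degreeOf_le_of_mem_coordDegreeSpace, fun h =>
    (mem_restrictSupport_iff F).2 fun s hs i => degreeOf_le_iff.1 (h i) s hs⟩

theorem coordDegreeSpace_mono {k n : Fin d → ℕ} (h : k ≤ n) :
    coordDegreeSpace F k ≤ coordDegreeSpace F n := fun _ hp =>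
  mem_coordDegreeSpace_iff.2 fun i => (mem_coordDegreeSpace_iff.1 hp i).trans (h i)

/-- Some `j i` exceeds `k i`, and `k i + 1` differences in one variable already kill degree `k i`.
-/
theorem backwardDiffPow_eq_zero_of_not_le {j k : Fin d → ℕ} {p : MvPolynomial (Fin d) F}
    (hp : p ∈ coordDegreeSpace F k) (h : ¬ j ≤ k) : backwardDiffPow F j p = 0 := by
  obtain ⟨i, hi⟩ : ∃ i, k i < j i := by simpa [Pi.le_def] using h
  rw [← Function.update_eq_self i j, backwardDiffPow_update_zero,
    (((backwardDiffPow_commute (F := F) _ i).pow_left (j i)).eq :), Module.End.mul_apply,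
    ← Nat.sub_add_cancel (Nat.succ_le_of_lt hi), pow_add, Module.End.mul_apply,
    backwardDiff_iterate i (k i) p (degreeOf_le_of_mem_coordDegreeSpace hp i), map_zero, map_zero]

/-- The product over `i` of the polynomials `(x_i + c_i) (x_i + c_i + 1) ⋯ (x_i + c_i + m_i - 1)`,
divided by `m!`. -/
noncomputable def shiftedRising (c : Fin d → F) (m : Fin d → ℕ) : MvPolynomial (Fin d) F :=
  C ((multiFactorial m : F)⁻¹) * ∏ i, risingFactorial (X i + C (c i)) (m i)

theorem shiftedRising_mem (c : Fin d → F) (m : Fin d → ℕ) :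
    shiftedRising c m ∈ coordDegreeSpace F m := by
  refine mem_coordDegreeSpace_iff.2 fun i => ?_
  refine (degreeOf_C_mul_le _ _ _).trans ((degreeOf_prod_le _ _ _).trans ?_)
  have h : ∀ j, (risingFactorial (X j + C (c j) : MvPolynomial (Fin d) F) (m j)).degreeOf i
      ≤ if j = i then m i else 0 := by
    intro j
    refine (degreeOf_prod_le _ _ _).trans ?_
    have : ∀ t ∈ Finset.range (m j),
        (X j + C (c j) + (t : MvPolynomial (Fin d) F)).degreeOf i ≤ if j = i then 1 else 0 := by
      intro t _
      rw [add_assoc, ← map_natCast (C : F →+* MvPolynomial (Fin d) F) t, ← C_add]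
      refine (degreeOf_add_le _ _ _).trans (max_le ?_ (by rw [degreeOf_C]; exact Nat.zero_le _))
      rw [degreeOf_X]
      simp [eq_comm]
    refine (Finset.sum_le_sum this).trans ?_
    split_ifs with hj
    · simp [hj]
    · simp
  exact (Finset.sum_le_sum fun j _ => h j).trans (by simp)

theorem multiFactorial_ne_zero [CharZero F] (m : Fin d → ℕ) : (multiFactorial m : F) ≠ 0 :=
  Nat.cast_ne_zero.2 (Finset.prod_ne_zero_iff.2 fun _ _ => Nat.factorial_ne_zero _)

/-- Only the `i`-th factor changes under the shift, and the `m i + 1` it produces cancels against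
the factorial. The constant `c` plays no role because differences commute with translations. -/
theorem backwardDiff_shiftedRising [CharZero F] (c : Fin d → F) (m : Fin d → ℕ) (i : Fin d) :
    backwardDiff F i (shiftedRising c (Function.update m i (m i + 1))) = shiftedRising c m := by
  have split : ∀ (l : ℕ) , (∏ j, risingFactorial (X j + C (c j) : MvPolynomial (Fin d) F)
      (Function.update m i l j)) = risingFactorial (X i + C (c i)) l *
        ∏ j ∈ Finset.univ.erase i, risingFactorial (X j + C (c j)) (m j) := by
    intro l
    rw [← Finset.mul_prod_erase _ _ (Finset.mem_univ i), Function.update_self]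
    congr 1
    refine Finset.prod_congr rfl fun j hj => ?_
    rw [Function.update_of_ne (Finset.ne_of_mem_erase hj)]
  have hfact : multiFactorial (Function.update m i (m i + 1)) = (m i + 1) * multiFactorial m := by
    unfold multiFactorial
    rw [← Finset.mul_prod_erase _ _ (Finset.mem_univ i),
      ← Finset.mul_prod_erase _ (fun j => (m j).factorial) (Finset.mem_univ i),
      Function.update_self, Nat.factorial_succ, mul_assoc]
    congr 2
    refine Finset.prod_congr rfl fun j hj => ?_
    rw [Function.update_of_ne (Finset.ne_of_mem_erase hj)]
  have hX : backwardShift F i (X i + C (c i)) = X i + C (c i) - 1 := by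
    simp [backwardShift]
    ring
  have hY : ∀ j ≠ i, backwardShift F i (X j + C (c j)) = X j + C (c j) := by
    intro j hj
    simp [backwardShift, hj]
  have hr : backwardShift F i (∏ j ∈ Finset.univ.erase i, risingFactorial (X j + C (c j)) (m j))
      = ∏ j ∈ Finset.univ.erase i, risingFactorial (X j + C (c j)) (m j) := by
    rw [map_prod]
    refine Finset.prod_congr rfl fun j hj => ?_
    rw [map_risingFactorial, hY j (Finset.ne_of_mem_erase hj)]
  have hc : backwardShift F i (C ((multiFactorial (Function.update m i (m i + 1)) : F)⁻¹))
      = C ((multiFactorial (Function.update m i (m i + 1)) : F)⁻¹) :=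
    (backwardShift F i).commutes _
  have hm : (((m i + 1 : ℕ) : F)) ≠ 0 := Nat.cast_ne_zero.2 (Nat.succ_ne_zero _)
  have hsplit := split (m i)
  rw [Function.update_eq_self] at hsplit
  rw [backwardDiff_apply, shiftedRising, shiftedRising, split, hsplit, map_mul, map_mul, hr, hc,
    map_risingFactorial, hX, ← mul_sub, ← sub_mul, risingFactorial_sub, hfact]
  have e : (C (((multiFactorial m : ℕ) : F)⁻¹) : MvPolynomial (Fin d) F)
      = C ((((m i + 1) * multiFactorial m : ℕ) : F)⁻¹) * ((m i : MvPolynomial (Fin d) F) + 1) := by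
    have : ((m i : MvPolynomial (Fin d) F) + 1) = C (((m i + 1 : ℕ) : F)) := by simp
    rw [this, ← C_mul, Nat.cast_mul, mul_inv, mul_right_comm, inv_mul_cancel₀ hm, one_mul]
  rw [e]
  ring

theorem backwardDiffPow_shiftedRising [CharZero F] (c : Fin d → F) {j m : Fin d → ℕ}
    (hj : j ≤ m) : backwardDiffPow F j (shiftedRising c m) = shiftedRising c (m - j) := by
  revert m
  refine multiIndex_induction (p := fun j => ∀ {m}, j ≤ m →
    backwardDiffPow F j (shiftedRising c m) = shiftedRising c (m - j)) ?_ ?_ j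
  · intro m _
    rw [backwardDiffPow_zero]
    simp
  · intro k i ih m hk
    have hki : k i < m i := by simpa using hk i
    rw [backwardDiffPow_succ, Module.End.mul_apply, ih]
    -- One more difference in direction `i` is available: `k i < m i`, so the truncated difference
    -- `m - k` is a successor in that coordinate.
    · have : m - k = Function.update (m - Function.update k i (k i + 1)) i
          ((m - Function.update k i (k i + 1)) i + 1) := by
        funext l
        by_cases hl : l = i
        · subst hl
          simp
          omega
        · simp [hl]
      rw [this, backwardDiff_shiftedRising]
    · exact le_trans (fun l => by by_cases hl : l = i <;> simp [hl]) hk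

theorem diffGoncarov_spec [CharZero F] (n : Fin d → ℕ) (Z : (Fin d → ℕ) → Fin d → F) :
    IsDiffGoncarov n Z (diffGoncarov n Z) :=
  (existsUnique_isDiffGoncarov n Z).choose_spec.1

/-- Newton-type expansion of a polynomial of coordinate degree `m` in difference Gončarov
polynomials. -/
theorem eq_sum_diffGoncarov [CharZero F] {m : Fin d → ℕ} (Z : (Fin d → ℕ) → Fin d → F)
    {q : MvPolynomial (Fin d) F} (hq : q ∈ coordDegreeSpace F m) :
    q = ∑ k ∈ Finset.Iic m, (eval (Z k) (backwardDiffPow F k q) / (multiFactorial k : F)) •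
      diffGoncarov k Z := by
  refine sub_eq_zero.1 (eq_zero_of_interpolation (n := m) Z (Submodule.sub_mem _ hq
    (Submodule.sum_mem _ fun k hk => Submodule.smul_mem _ _
      (coordDegreeSpace_mono (Finset.mem_Iic.1 hk) (diffGoncarov_spec k Z).1))) fun j hj => ?_)
  -- Biorthogonality for all pairs: where `j ≤ k` fails, the defining conditions say nothing and the
  -- degree bound gives zero instead.
  have key : ∀ k, eval (Z j) (backwardDiffPow F j (diffGoncarov k Z))
      = if j = k then (multiFactorial j : F) else 0 := by
    intro k
    by_cases h : j ≤ k
    · rw [(diffGoncarov_spec k Z).2 j h]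
      split_ifs with h'
      · rw [h']
      · rfl
    · rw [backwardDiffPow_eq_zero_of_not_le (diffGoncarov_spec k Z).1 h, map_zero, if_neg]
      rintro rfl
      exact h le_rfl
  simp only [map_sub, map_sum, map_smul, smul_eval, key]
  rw [Finset.sum_eq_single_of_mem j (Finset.mem_Iic.2 hj) fun k _ hk => by simp [hk.symm],
    if_pos rfl, div_mul_cancel₀ _ (multiFactorial_ne_zero j), sub_self]

theorem eval_shiftedRising [CharZero F] (c y : Fin d → F) (x m : Fin d → ℕ)
    (h : ∀ i, y i + c i = x i) :
    eval y (shiftedRising c m) = ((∏ i, (x i).multichoose (m i) : ℕ) : F) := by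
  have h1 : ∀ i, eval y (risingFactorial (X i + C (c i)) (m i))
      = ((m i).factorial : F) * ((x i).multichoose (m i) : F) := by
    intro i
    rw [map_risingFactorial, map_add, eval_X, eval_C, h, risingFactorial_natCast]
  rw [shiftedRising, map_mul, eval_C, map_prod, Finset.prod_congr rfl fun i _ => h1 i,
    Finset.prod_mul_distrib, ← mul_assoc, ← Nat.cast_prod, ← Nat.cast_prod]
  exact (congrArg (· * _) (inv_mul_cancel₀ (multiFactorial_ne_zero m))).trans (one_mul _)

/-- The convolution identity satisfied by the values of the difference Gončarov polynomials on an
integral grid. -/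
theorem sum_multichoose_mul_diffGoncarov [CharZero F] (c y : Fin d → F)
    (W : (Fin d → ℕ) → Fin d → F) (x m : Fin d → ℕ) (Z : (Fin d → ℕ) → Fin d → ℕ)
    (h : ∀ i, y i + c i = x i) (hZ : ∀ k, k ≤ m → ∀ i, W k i + c i = Z k i) :
    ((∏ i, (x i).multichoose (m i) : ℕ) : F) = ∑ k ∈ Finset.Iic m,
      ((∏ i, (Z k i).multichoose ((m - k) i) : ℕ) : F) *
        (1 / (multiFactorial k : F) * eval y (diffGoncarov k W)) := by
  rw [← eval_shiftedRising c y x m h]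
  conv_lhs => rw [eq_sum_diffGoncarov W (shiftedRising_mem c m)]
  rw [map_sum]
  refine Finset.sum_congr rfl fun k hk => ?_
  rw [Finset.mem_Iic] at hk
  rw [smul_eval, backwardDiffPow_shiftedRising c hk, eval_shiftedRising c _ _ _ (hZ k hk)]
  ring

/-- A unitriangular system of equations has at most one solution. -/
theorem eq_of_unitriangular {R : Type*} [CommRing R] (A : (Fin d → ℕ) → (Fin d → ℕ) → R)
    (n : Fin d → ℕ) (f g : (Fin d → ℕ) → R) (hA : ∀ k, A k k = 1)
    (h : ∀ m, m ≤ n → ∑ k ∈ Finset.Iic m, A m k * f k = ∑ k ∈ Finset.Iic m, A m k * g k)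
    (m : Fin d → ℕ) (hm : m ≤ n) : f m = g m := by
  induction m using WellFoundedLT.induction with
  | _ m ih =>
    have hs := h m hm
    have he : ∑ k ∈ (Finset.Iic m).erase m, A m k * f k
        = ∑ k ∈ (Finset.Iic m).erase m, A m k * g k := by
      refine Finset.sum_congr rfl fun k hk => ?_
      rw [Finset.mem_erase, Finset.mem_Iic] at hk
      rw [ih k (lt_of_le_of_ne hk.2 hk.1) (hk.2.trans hm)]
    rw [← Finset.add_sum_erase _ _ (Finset.mem_Iic.2 (le_refl m)),
      ← Finset.add_sum_erase _ (fun k => A m k * g k) (Finset.mem_Iic.2 (le_refl m)), he, hA] at hs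
    simpa using hs

end Expansion

/-! ### Counting non-decreasing sequences. -/

/-- The non-decreasing sequences of length `l` with values below `y`, extended by zero. -/
def monoSeq (y l : ℕ) : Set (ℕ → ℕ) :=
  {b | (∀ i j, i ≤ j → j < l → b i ≤ b j) ∧ (∀ j, j < l → b j < y) ∧ ∀ j, l ≤ j → b j = 0}

theorem monoSeq_zero_right (y : ℕ) : monoSeq y 0 = {0} := by
  ext b
  simp [monoSeq, funext_iff]

theorem monoSeq_zero_succ (l : ℕ) : monoSeq 0 (l + 1) = ∅ := by
  ext b
  simp only [monoSeq, Set.mem_ofPred_eq, Set.mem_empty_iff_false, iff_false]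
  rintro ⟨_, h, _⟩
  exact absurd (h 0 (Nat.succ_pos _)) (Nat.not_lt_zero _)

/-- The case distinction is whether the last entry attains the largest allowed value `y`. -/
theorem monoSeq_succ_succ (y l : ℕ) : monoSeq (y + 1) (l + 1)
    = monoSeq y (l + 1) ∪ (fun b => Function.update b l y) '' monoSeq (y + 1) l := by
  ext b
  constructor
  · rintro ⟨h1, h2, h3⟩
    by_cases hb : b l < y
    · exact Or.inl ⟨h1, fun j hj => (h1 j l (by omega) (by omega)).trans_lt hb, h3⟩
    · have hbl : b l = y := by have := h2 l (by omega); omega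
      -- Shortening must reset position `l` to the default `0`, as membership in `monoSeq (y + 1) l`
      -- demands.
      refine Or.inr ⟨Function.update b l 0, ⟨fun i j hij hj => ?_, fun j hj => ?_, fun j hj => ?_⟩,
        ?_⟩
      · rw [Function.update_of_ne (by omega), Function.update_of_ne (by omega)]
        exact h1 i j hij (by omega)
      · rw [Function.update_of_ne (by omega)]
        exact h2 j (by omega)
      · by_cases hjl : j = l
        · rw [hjl, Function.update_self]
        · rw [Function.update_of_ne hjl]
          exact h3 j (by omega)
      · simp only [Function.update_idem]
        rw [← hbl, Function.update_eq_self]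
  · rintro (⟨h1, h2, h3⟩ | ⟨c, ⟨h1, h2, h3⟩, rfl⟩)
    · exact ⟨h1, fun j hj => (h2 j hj).trans (Nat.lt_succ_self _), h3⟩
    · refine ⟨fun i j hij hj => ?_, fun j hj => ?_, fun j hj => ?_⟩
      · simp only [Function.update_apply]
        split_ifs with hi hj' hj'
        · exact le_rfl
        · omega
        · have := h2 i (by omega)
          omega
        · exact h1 i j hij (by omega)
      · simp only [Function.update_apply]
        split_ifs
        · omega
        · exact h2 j (by omega)
      · simp only [Function.update_apply]
        rw [if_neg (by omega)]
        exact h3 j (by omega)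

/-- The decomposition by the last entry is Pascal's rule for `multichoose`. Finiteness is carried
along because `ncard` is additive only on finite sets. -/
theorem finite_and_ncard_monoSeq (y l : ℕ) :
    (monoSeq y l).Finite ∧ (monoSeq y l).ncard = y.multichoose l := by
  induction l generalizing y with
  | zero => simp [monoSeq_zero_right]
  | succ l ihl =>
    induction y with
    | zero => simp [monoSeq_zero_succ]
    | succ y ihy =>
      have hinj : Set.InjOn (fun b => Function.update b l y) (monoSeq (y + 1) l) := by
        intro b hb c hc h
        funext j
        by_cases hj : j = l
        · rw [hj, hb.2.2 l le_rfl, hc.2.2 l le_rfl]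
        · simpa [hj] using congrFun h j
      have hdisj : Disjoint (monoSeq y (l + 1))
          ((fun b => Function.update b l y) '' monoSeq (y + 1) l) := by
        refine Set.disjoint_left.2 ?_
        rintro _ ⟨_, h, _⟩ ⟨c, _, rfl⟩
        have := h l (Nat.lt_succ_self l)
        simp at this
      rw [monoSeq_succ_succ]
      refine ⟨ihy.1.union ((ihl _).1.image _), ?_⟩
      rw [Set.ncard_union_eq hdisj ihy.1 ((ihl _).1.image _), hinj.ncard_image, ihy.2,
        (ihl _).2, Nat.multichoose_succ_succ]

/-! ### The walk driven by a tuple, its terminal point, and the combinatorial convolution identity.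
-/

section PathBounded

variable {d : ℕ}

/-- Tuples of non-decreasing sequences, extended by zero. -/
def monoSeqs (x n : Fin d → ℕ) : Set (Fin d → ℕ → ℕ) :=
  Set.univ.pi fun i => monoSeq (x i) (n i)

theorem mem_monoSeqs {x n : Fin d → ℕ} {a : Fin d → ℕ → ℕ} :
    a ∈ monoSeqs x n ↔ ∀ i, a i ∈ monoSeq (x i) (n i) := by
  simp [monoSeqs]

theorem finite_monoSeqs (x n : Fin d → ℕ) : (monoSeqs x n).Finite :=
  Set.Finite.pi fun i => (finite_and_ncard_monoSeq (x i) (n i)).1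

theorem ncard_monoSeqs (x n : Fin d → ℕ) :
    (monoSeqs x n).ncard = ∏ i, (x i).multichoose (n i) := by
  have : ∀ i, (x i).multichoose (n i) = Nat.card (monoSeq (x i) (n i)) := fun i =>
    (finite_and_ncard_monoSeq (x i) (n i)).2.symm
  simp_rw [this]
  rw [← Nat.card_pi]
  exact Nat.card_congr (Equiv.Set.univPi _)

/-- The lattice points that can be reached from the origin by steps that respect the bounds which
the weights `U` impose on the sequences `a`. -/
inductive Reach (U : (Fin d → ℕ) → Fin d → ℕ) (a : Fin d → ℕ → ℕ) : (Fin d → ℕ) → Prop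
  | zero : Reach U a 0
  | step (k : Fin d → ℕ) (i : Fin d) : Reach U a k → a i (k i) < U k i →
      Reach U a (Function.update k i (k i + 1))

theorem le_update_succ (k : Fin d → ℕ) (i : Fin d) : k ≤ Function.update k i (k i + 1) := by
  intro j
  by_cases hj : j = i <;> simp [hj]

/-- A walk to `k` inspects only entries with index below `k i`, so the tail of the tuple can be
replaced freely. -/
theorem Reach.congr {U : (Fin d → ℕ) → Fin d → ℕ} {a b : Fin d → ℕ → ℕ} {k : Fin d → ℕ}
    (h : Reach U a k) (hab : ∀ i j, j < k i → a i j = b i j) : Reach U b k := by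
  induction h with
  | zero => exact Reach.zero
  | step k i _ hlt ih =>
    refine Reach.step k i (ih fun l j hj => hab l j (hj.trans_le (le_update_succ k i l))) ?_
    rwa [← hab i (k i) (by simp)]

/-- Entry `j` was tested at an earlier point of the walk, whose weight is at most `U k i` by
monotonicity. -/
theorem Reach.lt_weight {U : (Fin d → ℕ) → Fin d → ℕ} {n : Fin d → ℕ}
    (hmono : ∀ k k', k ≤ k' → k' ≤ n → ∀ i, U k i ≤ U k' i)
    {a : Fin d → ℕ → ℕ} {k : Fin d → ℕ} (h : Reach U a k) (hk : k ≤ n) (i : Fin d) (j : ℕ)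
    (hj : j < k i) : a i j < U k i := by
  induction h with
  | zero => exact absurd hj (Nat.not_lt_zero _)
  | step k l _ hlt ih =>
    have hU := hmono _ _ (le_update_succ k l) hk i
    by_cases hjk : j < k i
    · exact (ih ((le_update_succ k l).trans hk) hjk).trans_le hU
    · by_cases hil : i = l
      · subst hil
        rw [Function.update_self] at hj
        obtain rfl : j = k i := by omega
        exact hlt.trans_le hU
      · rw [Function.update_of_ne hil] at hj
        exact absurd hj hjk

/-- No admissible step inside the box below `n` starts at `k`. -/
def IsTerminal (U : (Fin d → ℕ) → Fin d → ℕ) (a : Fin d → ℕ → ℕ) (n k : Fin d → ℕ) : Prop :=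
  ∀ i, k i < n i → U k i ≤ a i (k i)

/-- This makes terminal points unique. A walk leaving the region below `k` would step in direction
`l` from some `q ≤ k` with `q l = k l`; but `U q l ≤ U k l ≤ a l (k l)` forbids that step. -/
theorem Reach.le_of_isTerminal {U : (Fin d → ℕ) → Fin d → ℕ} {n : Fin d → ℕ}
    (hmono : ∀ k k', k ≤ k' → k' ≤ n → ∀ i, U k i ≤ U k' i)
    {a : Fin d → ℕ → ℕ} {q k : Fin d → ℕ} (h : Reach U a q) (hq : q ≤ n) (hk : k ≤ n)
    (ht : IsTerminal U a n k) : q ≤ k := by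
  induction h with
  | zero => exact fun i => Nat.zero_le _
  | step q i _ hlt ih =>
    have hqk := ih ((le_update_succ q i).trans hq)
    intro l
    by_cases hl : l = i
    · subst hl
      rw [Function.update_self]
      have hqn : q l < n l := by simpa using hq l
      refine lt_of_le_of_ne (hqk l) fun he => ?_
      have h1 := ht l (he ▸ hqn)
      have h2 := hmono q k hqk hk l
      rw [← he] at h1
      omega
    · rw [Function.update_of_ne hl]
      exact hqk l

/-- A maximal reachable point of the finite box is terminal, since an admissible step would lead to
a larger one. -/
theorem exists_reach_isTerminal (U : (Fin d → ℕ) → Fin d → ℕ) (a : Fin d → ℕ → ℕ)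
    (n : Fin d → ℕ) : ∃ k ≤ n, Reach U a k ∧ IsTerminal U a n k := by
  have hfin : {k | k ≤ n ∧ Reach U a k}.Finite := (Set.finite_Iic n).subset fun k hk => hk.1
  obtain ⟨k, hk⟩ := hfin.exists_maximal ⟨0, fun i => Nat.zero_le _, Reach.zero⟩
  refine ⟨k, hk.prop.1, hk.prop.2, fun i hi => ?_⟩
  by_contra! hlt
  have hle : Function.update k i (k i + 1) ≤ n := by
    intro j
    by_cases hj : j = i
    · subst hj
      simpa using hi
    · simpa [hj] using hk.prop.1 j
  have := hk.le_of_ge ⟨hle, Reach.step k i hk.prop.2 hlt⟩ (le_update_succ k i) i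
  simp at this

/-- The tuples of sequences that can be followed all the way up to `n`. -/
def reachSeqs (x : Fin d → ℕ) (U : (Fin d → ℕ) → Fin d → ℕ) (n : Fin d → ℕ) :
    Set (Fin d → ℕ → ℕ) :=
  {a | a ∈ monoSeqs x n ∧ Reach U a n}

/-- A tuple of sequences with terminal point `k` consists of a tuple that can be followed up to `k`
and of an arbitrary tuple of non-decreasing sequences bounded below by `U k`. -/
theorem bijOn_split {x n : Fin d → ℕ} {Z U : (Fin d → ℕ) → Fin d → ℕ}
    (hmono : ∀ k k', k ≤ k' → k' ≤ n → ∀ i, U k i ≤ U k' i) {k : Fin d → ℕ} (hk : k ≤ n)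
    (hU : ∀ i, U k i + Z k i = x i) :
    Set.BijOn (fun p : (Fin d → ℕ → ℕ) × (Fin d → ℕ → ℕ) => fun i j =>
        if j < k i then p.1 i j else if j < n i then p.2 i (j - k i) + U k i else 0)
      (reachSeqs x U k ×ˢ monoSeqs (Z k) (n - k))
      {a | a ∈ monoSeqs x n ∧ Reach U a k ∧ IsTerminal U a n k} := by
  refine ⟨?_, ?_, ?_⟩
  · rintro ⟨a, b⟩ ⟨⟨ha, hr⟩, hb⟩
    rw [mem_monoSeqs] at ha hb
    refine ⟨mem_monoSeqs.2 fun i => ?_, hr.congr fun i j hj => by simp [hj], fun i hi => ?_⟩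
    · obtain ⟨a1, a2, a3⟩ := ha i
      obtain ⟨b1, b2, b3⟩ := hb i
      have hki : k i ≤ n i := hk i
      have hUi := hU i
      simp only [Pi.sub_apply] at b1 b2 b3
      refine ⟨fun j l hjl hl => ?_, fun j hj => ?_, fun j hj => ?_⟩
      · simp only
        by_cases hlk : l < k i
        · rw [if_pos (by omega), if_pos hlk]
          exact a1 j l hjl hlk
        · rw [if_neg hlk, if_pos hl]
          by_cases hjk : j < k i
          · rw [if_pos hjk]
            -- At the junction, prefix entries lie below `U k i` while suffix entries have been
            -- raised by `U k i`.
            have := hr.lt_weight hmono hk i j hjk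
            simp only at this
            omega
          · rw [if_neg hjk, if_pos (by omega)]
            have := b1 (j - k i) (l - k i) (by omega) (by omega)
            omega
      · simp only
        by_cases hjk : j < k i
        · rw [if_pos hjk]
          exact a2 j hjk
        · rw [if_neg hjk, if_pos hj]
          have := b2 (j - k i) (by omega)
          omega
      · simp only
        rw [if_neg (by omega), if_neg (by omega)]
    · simp [hi]
  · rintro ⟨a, b⟩ ⟨⟨ha, -⟩, hb⟩ ⟨a', b'⟩ ⟨⟨ha', -⟩, hb'⟩ h
    rw [mem_monoSeqs] at ha hb ha' hb'
    simp only at ha hb ha' hb'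
    have h' : ∀ i j, _ := fun i j => congrFun (congrFun h i) j
    simp only at h'
    refine Prod.ext (funext fun i => funext fun j => ?_) (funext fun i => funext fun j => ?_)
    all_goals have hki : k i ≤ n i := hk i
    · by_cases hj : j < k i
      · simpa [hj] using h' i j
      · simp only
        rw [(ha i).2.2 j (by omega), (ha' i).2.2 j (by omega)]
    · by_cases hj : j < n i - k i
      -- The suffix is read off at positions shifted by `k i`.
      · have := h' i (j + k i)
        have h1 : ¬ j + k i < k i := by omega
        have h2 : j + k i < n i := by omega
        simpa [h1, h2] using this
      · simp only
        rw [(hb i).2.2 j (by simp only [Pi.sub_apply]; omega),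
          (hb' i).2.2 j (by simp only [Pi.sub_apply]; omega)]
  · rintro a ⟨ha, hr, ht⟩
    rw [mem_monoSeqs] at ha
    refine ⟨(fun i j => if j < k i then a i j else 0,
      fun i j => if j < n i - k i then a i (j + k i) - U k i else 0),
      ⟨⟨mem_monoSeqs.2 fun i => ?_, hr.congr fun i j hj => by simp [hj]⟩,
        mem_monoSeqs.2 fun i => ?_⟩, ?_⟩
    · obtain ⟨a1, a2, a3⟩ := ha i
      have hki : k i ≤ n i := hk i
      refine ⟨fun j l hjl hl => ?_, fun j hj => ?_, fun j hj => ?_⟩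
      · simp only
        rw [if_pos (by omega), if_pos hl]
        exact a1 j l hjl (by omega)
      · simp only
        rw [if_pos hj]
        exact a2 j (by omega)
      · simp only
        rw [if_neg (by omega)]
    · obtain ⟨a1, a2, a3⟩ := ha i
      have hki : k i ≤ n i := hk i
      have hUi := hU i
      refine ⟨fun j l hjl hl => ?_, fun j hj => ?_, fun j hj => ?_⟩
      · simp only [Pi.sub_apply] at hl ⊢
        rw [if_pos (by omega), if_pos hl]
        exact Nat.sub_le_sub_right (a1 _ _ (by omega) (by omega)) _
      · simp only [Pi.sub_apply] at hj ⊢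
        rw [if_pos hj]
        -- Terminality bounds the first unused entry below by `U k i`, and monotonicity extends this
        -- to all later ones, so subtracting `U k i` loses nothing and leaves a value below `Z k i`.
        have h1 := ht i (by omega)
        have h2 := a1 (k i) (j + k i) (by omega) (by omega)
        have h3 := a2 (j + k i) (by omega)
        omega
      · simp only [Pi.sub_apply] at hj ⊢
        rw [if_neg (by omega)]
    · funext i j
      simp only
      by_cases hjk : j < k i
      · simp [hjk]
      · by_cases hj : j < n i
        · rw [if_neg hjk, if_pos hj, if_pos (by omega), Nat.sub_add_cancel (not_lt.1 hjk)]
          have h1 := ht i (by omega)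
          have h2 := (ha i).1 (k i) j (by omega) hj
          omega
        · rw [if_neg hjk, if_neg hj, (ha i).2.2 j (by omega)]

/-- The convolution identity satisfied by the numbers of path-bounded tuples of sequences. -/
theorem sum_ncard_reachSeqs {x n : Fin d → ℕ} {Z U : (Fin d → ℕ) → Fin d → ℕ}
    (hmono : ∀ k k', k ≤ k' → k' ≤ n → ∀ i, U k i ≤ U k' i)
    (hU : ∀ k, k ≤ n → ∀ i, U k i + Z k i = x i) :
    ∏ i, (x i).multichoose (n i) = ∑ k ∈ Finset.Iic n,
      (∏ i, (Z k i).multichoose ((n - k) i)) * (reachSeqs x U k).ncard := by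
  let S : (Fin d → ℕ) → Set (Fin d → ℕ → ℕ) := fun k =>
    {a | a ∈ monoSeqs x n ∧ Reach U a k ∧ IsTerminal U a n k}
  have hcover : monoSeqs x n = ⋃ k ∈ (Finset.Iic n : Set (Fin d → ℕ)), S k := by
    ext a
    simp only [Set.mem_iUnion, Finset.mem_coe, Finset.mem_Iic, S, Set.mem_ofPred_eq, exists_prop]
    constructor
    · intro ha
      obtain ⟨k, hk, hr, ht⟩ := exists_reach_isTerminal U a n
      exact ⟨k, hk, ha, hr, ht⟩
    · rintro ⟨k, _, ha, _⟩
      exact ha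
  have hdisj : (Finset.Iic n : Set (Fin d → ℕ)).PairwiseDisjoint S := by
    intro k hk l hl hne
    rw [Finset.mem_coe, Finset.mem_Iic] at hk hl
    refine Set.disjoint_left.2 fun a ha hb => hne (le_antisymm ?_ ?_)
    · exact ha.2.1.le_of_isTerminal hmono hk hl hb.2.2
    · exact hb.2.1.le_of_isTerminal hmono hl hk ha.2.2
  rw [← ncard_monoSeqs, hcover, (Finset.finite_toSet _).ncard_biUnion
    (fun k _ => (finite_monoSeqs x n).subset fun a ha => ha.1) hdisj, finsum_mem_coe_finset]
  refine Finset.sum_congr rfl fun k hk => ?_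
  rw [Finset.mem_Iic] at hk
  rw [← (bijOn_split hmono hk (hU k hk)).ncard_eq, Set.ncard_prod, ncard_monoSeqs, mul_comm]

/-! ### Lattice paths as step lists versus reachability. -/

theorem LatticePath.position_succ {n : Fin d → ℕ} (P : LatticePath n) (r : Fin P.steps.length) :
    P.position (r + 1) = Function.update (P.position r) (P.steps.get r)
      (P.position r (P.steps.get r) + 1) := by
  funext i
  simp only [position, List.take_add_one, List.count_append, List.getElem?_eq_getElem r.2,
    Option.toList_some, List.get_eq_getElem, List.count_singleton, Function.update_apply]
  by_cases h : i = P.steps[(r : ℕ)]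
  · simp [← h]
  · simp [h, Ne.symm h]

theorem LatticePath.reach {n : Fin d → ℕ} {U : (Fin d → ℕ) → Fin d → ℕ} {a : Fin d → ℕ → ℕ}
    (P : LatticePath n) (h : ∀ r : Fin P.steps.length,
      a (P.steps.get r) (P.position r (P.steps.get r)) < U (P.position r) (P.steps.get r)) :
    Reach U a n := by
  have key : ∀ r ≤ P.steps.length, Reach U a (P.position r) := by
    intro r
    induction r with
    | zero =>
      intro _
      have : P.position 0 = 0 := by
        funext i
        simp [position]
      exact this ▸ Reach.zero
    | succ r ih =>
      intro hr
      rw [P.position_succ ⟨r, hr⟩]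
      exact Reach.step _ _ (ih (by omega)) (h ⟨r, hr⟩)
  have : P.position P.steps.length = n := by
    funext i
    simp [position, P.count_steps]
  exact this ▸ key _ le_rfl

theorem Reach.exists_latticePath {k : Fin d → ℕ} {U : (Fin d → ℕ) → Fin d → ℕ}
    {a : Fin d → ℕ → ℕ} (h : Reach U a k) : ∃ P : LatticePath k, ∀ r : Fin P.steps.length,
      a (P.steps.get r) (P.position r (P.steps.get r)) < U (P.position r) (P.steps.get r) := by
  induction h with
  | zero => exact ⟨⟨[], by simp⟩, fun r => r.elim0⟩
  | step k i _ hlt ih =>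
    obtain ⟨P, hP⟩ := ih
    refine ⟨⟨P.steps ++ [i], fun j => ?_⟩, ?_⟩
    · rw [List.count_append, P.count_steps, List.count_singleton, Function.update_apply]
      by_cases hj : j = i
      · simp [hj]
      · simp [hj, Ne.symm hj]
    · rintro ⟨r, hr⟩
      change a (P.steps ++ [i])[r] (((P.steps ++ [i]).take r).count (P.steps ++ [i])[r])
        < U (fun j => ((P.steps ++ [i]).take r).count j) (P.steps ++ [i])[r]
      have hr' : r < P.steps.length + 1 := by simpa using hr
      by_cases hlt' : r < P.steps.length
      · rw [List.getElem_append_left hlt', List.take_append_of_le_length hlt'.le]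
        exact hP ⟨r, hlt'⟩
      -- The appended step starts at the endpoint `k` of `P`, so its condition is the one attached
      -- to the last `Reach` step.
      · obtain rfl : r = P.steps.length := by omega
        simp only [List.getElem_concat_length, List.take_left', P.count_steps]
        exact hlt

/-- Extension by zero gives the bijection; the union over paths turns into reachability of `n`, so a
tuple bounded by several paths is counted once. -/
theorem ncard_iUnion_pathBoundedSequences (x n : Fin d → ℕ) (U : (Fin d → ℕ) → Fin d → ℕ) :
    (⋃ P : LatticePath n, pathBoundedSequences x n U P).ncard = (reachSeqs x U n).ncard := by
  refine Set.BijOn.ncard_eq (f := fun a i j => if h : j < n i then a i ⟨j, h⟩ else 0) ⟨?_, ?_, ?_⟩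
  · intro a ha
    obtain ⟨P, ⟨ha, hP⟩⟩ := Set.mem_iUnion.1 ha
    refine ⟨mem_monoSeqs.2 fun i => ⟨fun j l hjl hl => ?_, fun j hj => ?_, fun j hj => ?_⟩,
      P.reach fun r => ?_⟩
    · simp only
      rw [dif_pos hl, dif_pos (by omega)]
      exact (ha i).1 hjl
    · simp only
      rw [dif_pos hj]
      exact (ha i).2 _
    · simp only
      rw [dif_neg (by omega)]
    · simp only
      rw [dif_pos (P.position_lt r)]
      exact hP r
  · intro a _ b _ h
    funext i j
    simpa using congrFun (congrFun h i) j
  · rintro a ⟨ha, hr⟩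
    rw [mem_monoSeqs] at ha
    obtain ⟨P, hP⟩ := hr.exists_latticePath
    refine ⟨fun i j => a i j, Set.mem_iUnion.2 ⟨P, fun i => ⟨fun j l hjl => ?_, fun j => ?_⟩, hP⟩,
      ?_⟩
    · exact (ha i).1 j l hjl l.2
    · exact (ha i).2.1 j j.2
    · funext i j
      simp only
      split_ifs with h
      · rfl
      · exact ((ha i).2.2 j (by omega)).symm

/-- The translation `c` lets one statement cover both evaluations: only `y + c` and `W k + c` enter
the convolution identity. -/
theorem ncard_eq_eval_diffGoncarov {F : Type*} [Field F] [CharZero F] {x n : Fin d → ℕ}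
    {Z U : (Fin d → ℕ) → Fin d → ℕ} (hmono : ∀ k k', k ≤ k' → k' ≤ n → ∀ i, U k i ≤ U k' i)
    (hU : ∀ k, k ≤ n → ∀ i, U k i + Z k i = x i) (c y : Fin d → F)
    (W : (Fin d → ℕ) → Fin d → F) (h : ∀ i, y i + c i = x i)
    (hW : ∀ k, k ≤ n → ∀ i, W k i + c i = Z k i) :
    ((⋃ P : LatticePath n, pathBoundedSequences x n U P).ncard : F)
      = 1 / (multiFactorial n : F) * eval y (diffGoncarov n W) := by
  rw [ncard_iUnion_pathBoundedSequences]
  refine eq_of_unitriangular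
    (fun m k => ((∏ i, (Z k i).multichoose ((m - k) i) : ℕ) : F)) n
    (fun k => ((reachSeqs x U k).ncard : F))
    (fun k => 1 / (multiFactorial k : F) * eval y (diffGoncarov k W)) (fun k => by simp)
    (fun m hm => ?_) n le_rfl
  -- Both convolution identities are used with `m` in place of `n`; the weights at `k` do not depend
  -- on the box.
  rw [← sum_multichoose_mul_diffGoncarov c y W x m Z h fun k hk => hW k (hk.trans hm),
    sum_ncard_reachSeqs (n := m) (fun k l hkl hl => hmono k l hkl (hl.trans hm))
      fun k hk => hU k (hk.trans hm)]
  push_cast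
  rfl

end PathBounded

theorem theorem15 {F : Type*} [Field F] [CharZero F] {d : ℕ} (x n : Fin d → ℕ)
    (Z U : (Fin d → ℕ) → Fin d → ℕ)
    (hU : ∀ k, k ≤ n → ∀ i, (U k i : ℤ) = (x i : ℤ) - (Z k i : ℤ))
    (hmono : ∀ k k', k ≤ k' → k' ≤ n → ∀ i, U k i ≤ U k' i) :
    ((⋃ P : LatticePath n, pathBoundedSequences x n U P).ncard : F)
        = 1 / (multiFactorial n : F) *
            MvPolynomial.eval (fun i => (x i : F)) (diffGoncarov n fun k i => (Z k i : F)) ∧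
      ((⋃ P : LatticePath n, pathBoundedSequences x n U P).ncard : F)
        = 1 / (multiFactorial n : F) *
            MvPolynomial.eval 0 (diffGoncarov n fun k i => -(U k i : F)) := by
  have hUZ : ∀ k, k ≤ n → ∀ i, U k i + Z k i = x i := by
    intro k hk i
    have := hU k hk i
    omega
  -- Translation by `0` gives the value at `x` on the grid `Z`; translation by `x` gives the value
  -- at `0` on the grid `-U`, because `-U k i + x i = Z k i`.
  refine ⟨ncard_eq_eval_diffGoncarov hmono hUZ 0 _ _ (fun i => by simp) (fun k _ i => by simp),
    ncard_eq_eval_diffGoncarov hmono hUZ (fun i => (x i : F)) _ _ (fun i => by simp)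
      fun k hk i => ?_⟩
  rw [← hUZ k hk i]
  push_cast
  ring
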